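/- **Definitions.** A *standard probability space* is a probability space $(X,\mathcal F,\mu)$ such that $(X,\mathcal F)$ is the completion, with respect to the $\mu$-negligible sets, of a standard Borel space on $X$. A *standard enhanced measurable space* is a triple $(X,\mathcal F,\mathcal N)$ for which there is a measure $\mu$ with family of negligible sets $\mathcal N$ making $(X,\mathcal F,\mu)$ a standard probability space. - $\mathbf{Prob}_{\rm std}$ is the category of standard probability spaces and measure-preserving measurable maps, modulo $f\sim g$ iff $\{x: f(x)\neq g(x)\}$ is negligible. - $\mathbf{Mble}_{\rm std}$ is the category of standard enhanced measurable spaces, whose morphisms $(X,\mathcal F,\mathcal N)\to(Y,\mathcal G,\mathcal M)$ are the measurable maps $f$ such that $f^{-1}(M)\in\mathcal N$ for all $M\in\mathcal M$, and, for all $G\in\mathcal G$, $f^{-1}(G)\in\mathcal N$ implies $G\in\mathcal M$; modulo $f\sim g$ iff $\{x: f(x)\ne g(x)\}\in\mathcal N$. A *probability algebra* is a pair $(\mathfrak A,\bar\mu)$ of a complete Boolean algebra $\mathfrak A$ and a function $\bar\mu:\mathfrak A\to[0,1]$ with $\bar\mu(\bot)=0$, $\bar\mu(\top)=1$, $\bar\mu(a)>0$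 for $a\neq\bot$, and $\bar\mu(\bigvee_{i\in\mathbb N} a_i)=\sum_{i\in\mathbb N}\bar\mu(a_i)$ for all pairwise disjoint sequences $(a_i)$. It is *standard* if there is a countable (possibly finite or empty) family of weights $q_i>0$, $i\in I$, such that $(\mathfrak A,\bar\mu)$ is isomorphic either to the simple product $\prod_{i\in I}\{\bot,\top\}_{q_i}$ or, for some $p\in(0,1]$, to the simple product $\mathfrak L_p\times\prod_{i\in I}\{\bot,\top\}_{q_i}$. Here $\{\bot,\top\}_q$ is the two-element algebra whose top element has measure $q$, $\mathfrak L_p$ is the algebra of Lebesgue measurable subsets of $[0,p]$ modulo null sets with Lebesgue measure, and in a simple product the Boolean operations are pointwise and the measure is the sum of the measures of the components. A *standard measurable algebra* is a complete Boolean algebra $\mathfrak A$ for which there is some $\bar\mu$ making $(\mathfrak A,\bar\mu)$ a standard probability algebra. - $\mathbf{ProbAlg}_{\rm std}$ is the category of standard probability algebras and measure-preserving complete Boolean algebra homomorphisms. - $\mathbf{MbleAlg}_{\rm std}$ is the category of standard measurable algebras and injective complete Boolean algebra homomorphisms. **Statement.** 1. The assignment $(X,\mathcal F,\mathcal N)\mapsto\mathcal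 F/\mathcal N$, where $[F]=[F']$ iff $F\triangle F'\in\mathcal N$, on objects, and $[f]\mapsto\bigl([G]\mapsto[f^{-1}(G)]\bigr)$ on morphisms, defines a functor $\mathbf{Mble}_{\rm std}\to\mathbf{MbleAlg}_{\rm std}^{\rm op}$, and this functor is an equivalence of categories. 2. The assignment $(X,\mathcal F,\mu)\mapsto(\mathcal F/\mathcal N_\mu,\bar\mu)$, where $\mathcal N_\mu$ is the family of $\mu$-negligible sets and $\bar\mu[F]=\mu(F)$, on objects, and $[f]\mapsto\bigl([G]\mapsto[f^{-1}(G)]\bigr)$ on morphisms, defines a functor $\mathbf{Prob}_{\rm std}\to\mathbf{ProbAlg}_{\rm std}^{\rm op}$, and this functor is an equivalence of categories. -/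

import Mathlib

open MeasureTheory CategoryTheory Set
open scoped ENNReal symmDiff

universe u

/-! ### Standard probability spaces and standard enhanced measurable spaces -/

/-- `(X, 𝓕, μ)` is a standard probability space: `μ` is a probability measure and `𝓕` is the
completion, with respect to the `μ`-negligible sets, of a standard Borel σ-algebra `𝓑` on `X`:
the members of `𝓕` are the sets squeezed between two members of `𝓑` whose difference is null. -/
structure IsStdProbSpace {X : Type u} [F : MeasurableSpace X] (μ : Measure X) : Prop where
  isProb : IsProbabilityMeasure μ
  exists_borel : ∃ B : MeasurableSpace X, @StandardBorelSpace X B ∧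
    ∀ s : Set X, MeasurableSet[F] s ↔
      ∃ t t' : Set X, MeasurableSet[B] t ∧ MeasurableSet[B] t' ∧
        t ⊆ s ∧ s ⊆ t' ∧ μ (t' \ t) = 0

/-- The negligible sets of a measure. -/
def negligibles {X : Type u} [MeasurableSpace X] (μ : Measure X) : Set (Set X) :=
  {s | μ s = 0}

/-- `N` is the family of negligible sets of some finite measure. -/
class IsNegligibles {X : Type u} [MeasurableSpace X] (N : Set (Set X)) : Prop where
  exists_measure : ∃ μ : Measure X, IsFiniteMeasure μ ∧ N = negligibles μ

instance {X : Type u} [MeasurableSpace X] (μ : Measure X) [IsFiniteMeasure μ] :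
    IsNegligibles (negligibles μ) := ⟨μ, inferInstance, rfl⟩

/-! ### The quotient Boolean algebra `𝓕/𝓝` -/

section MeasAlg

variable {X : Type u} [MeasurableSpace X]

/-- Two measurable sets are identified when their symmetric difference is negligible. -/
def negSetoid (N : Set (Set X)) [hN : IsNegligibles N] : Setoid {s : Set X // MeasurableSet s} where
  r s t := (s : Set X) ∆ (t : Set X) ∈ N
  iseqv := by
    obtain ⟨μ, -, rfl⟩ := hN.exists_measure
    simp only [negligibles, mem_ofPred_eq, measure_symmDiff_eq_zero_iff]
    exact ⟨fun _ => Filter.EventuallyEq.rfl, fun h => h.symm, fun h h' => h.trans h'⟩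

/-- The quotient `𝓕/𝓝` of the σ-algebra `𝓕` of measurable sets of `X` by the negligible sets. -/
def MeasAlg (N : Set (Set X)) [IsNegligibles N] : Type u := Quotient (negSetoid N)

namespace MeasAlg

variable {N : Set (Set X)} [IsNegligibles N]

/-- The class `[s]` of a measurable set `s`. -/
def mk (N : Set (Set X)) [IsNegligibles N] (s : {s : Set X // MeasurableSet s}) : MeasAlg N :=
  Quotient.mk (negSetoid N) s

theorem ind {p : MeasAlg N → Prop} (h : ∀ s, p (mk N s)) (a : MeasAlg N) : p a :=
  Quotient.ind h a

theorem mk_eq {s t : {s : Set X // MeasurableSet s}} :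
    mk N s = mk N t ↔ (s : Set X) ∆ (t : Set X) ∈ N :=
  ⟨fun h => Quotient.exact h, fun h => Quotient.sound h⟩

instance : LE (MeasAlg N) where
  le a b := ∃ s t, mk N s = a ∧ mk N t = b ∧ (s : Set X) \ (t : Set X) ∈ N

theorem mk_le {s t : {s : Set X // MeasurableSet s}} :
    mk N s ≤ mk N t ↔ (s : Set X) \ (t : Set X) ∈ N := by
  refine ⟨?_, fun h => ⟨s, t, rfl, rfl, h⟩⟩
  rintro ⟨s', t', hs, ht, h⟩
  rw [mk_eq] at hs ht
  obtain ⟨μ, -, rfl⟩ := IsNegligibles.exists_measure (N := N)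
  simp only [negligibles, mem_ofPred_eq, measure_symmDiff_eq_zero_iff, ← ae_le_set] at *
  exact hs.symm.le.trans (h.trans ht.le)

instance : PartialOrder (MeasAlg N) where
  le_refl a := by
    induction a using ind with | _ s
    obtain ⟨μ, -, rfl⟩ := IsNegligibles.exists_measure (N := N)
    rw [mk_le]
    simp [negligibles]
  le_trans a b c := by
    induction a using ind with | _ s
    induction b using ind with | _ t
    induction c using ind with | _ r
    obtain ⟨μ, -, rfl⟩ := IsNegligibles.exists_measure (N := N)
    rw [mk_le, mk_le, mk_le]
    simp only [negligibles, mem_ofPred_eq, ← ae_le_set]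
    exact fun h h' => h.trans h'
  le_antisymm a b := by
    induction a using ind with | _ s
    induction b using ind with | _ t
    obtain ⟨μ, -, rfl⟩ := IsNegligibles.exists_measure (N := N)
    rw [mk_le, mk_le, mk_eq]
    simp only [negligibles, mem_ofPred_eq, ← ae_le_set,
      measure_symmDiff_eq_zero_iff]
    exact fun h h' => h.antisymm h'

theorem mk_mono {s t : {s : Set X // MeasurableSet s}} (h : (s : Set X) ⊆ t) :
    mk N s ≤ mk N t := by
  rw [mk_le, sdiff_eq_empty.2 h]
  obtain ⟨μ, -, rfl⟩ := IsNegligibles.exists_measure (N := N)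
  simp [negligibles]

/-- Union of classes. -/
def sup : MeasAlg N → MeasAlg N → MeasAlg N :=
  Quotient.map₂ (· ⊔ ·) (by
    intro s s' h t t' h'
    obtain ⟨μ, -, rfl⟩ := IsNegligibles.exists_measure (N := N)
    change μ _ = 0 at h h'
    change μ _ = 0
    rw [measure_symmDiff_eq_zero_iff] at *
    exact h.union h')

/-- Intersection of classes. -/
def inf : MeasAlg N → MeasAlg N → MeasAlg N :=
  Quotient.map₂ (· ⊓ ·) (by
    intro s s' h t t' h'
    obtain ⟨μ, -, rfl⟩ := IsNegligibles.exists_measure (N := N)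
    change μ _ = 0 at h h'
    change μ _ = 0
    rw [measure_symmDiff_eq_zero_iff] at *
    exact h.inter h')

/-- Complement of a class. -/
def cpl : MeasAlg N → MeasAlg N :=
  Quotient.map (fun s => sᶜ) (by
    intro s s' h
    obtain ⟨μ, -, rfl⟩ := IsNegligibles.exists_measure (N := N)
    change μ _ = 0 at h
    change μ _ = 0
    rw [measure_symmDiff_eq_zero_iff] at *
    exact h.compl)

instance : Lattice (MeasAlg N) where
  sup := sup
  inf := inf
  le_sup_left a b := by
    induction a using ind with | _ s
    induction b using ind with | _ t
    exact mk_mono (t := s ⊔ t) subset_union_left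
  le_sup_right a b := by
    induction a using ind with | _ s
    induction b using ind with | _ t
    exact mk_mono (t := s ⊔ t) subset_union_right
  sup_le a b c := by
    induction a using ind with | _ s
    induction b using ind with | _ t
    induction c using ind with | _ r
    intro h h'
    change mk N (s ⊔ t) ≤ mk N r
    rw [mk_le] at *
    obtain ⟨μ, -, rfl⟩ := IsNegligibles.exists_measure (N := N)
    have e : ((s ⊔ t : {s : Set X // MeasurableSet s}) : Set X) \ r
        = ((s : Set X) \ r) ∪ ((t : Set X) \ r) := union_sdiff_distrib
    rw [e]
    exact measure_union_null h h'
  inf_le_left a b := by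
    induction a using ind with | _ s
    induction b using ind with | _ t
    exact mk_mono (s := s ⊓ t) inter_subset_left
  inf_le_right a b := by
    induction a using ind with | _ s
    induction b using ind with | _ t
    exact mk_mono (s := s ⊓ t) inter_subset_right
  le_inf a b c := by
    induction a using ind with | _ s
    induction b using ind with | _ t
    induction c using ind with | _ r
    intro h h'
    change mk N s ≤ mk N (t ⊓ r)
    rw [mk_le] at *
    obtain ⟨μ, -, rfl⟩ := IsNegligibles.exists_measure (N := N)
    have e : (s : Set X) \ ((t ⊓ r : {s : Set X // MeasurableSet s}) : Set X)
        = ((s : Set X) \ t) ∪ ((s : Set X) \ r) := sdiff_inter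
    rw [e]
    exact measure_union_null h h'

instance : BooleanAlgebra (MeasAlg N) where
  le_sup_inf a b c := by
    induction a using ind with | _ s
    induction b using ind with | _ t
    induction c using ind with | _ r
    exact mk_mono (s := (s ⊔ t) ⊓ (s ⊔ r)) (t := s ⊔ (t ⊓ r)) (le_sup_inf (α := Set X))
  compl := cpl
  top := mk N ⊤
  bot := mk N ⊥
  inf_compl_le_bot a := by
    induction a using ind with | _ s
    exact mk_mono (s := s ⊓ sᶜ) (t := ⊥) (inf_compl_eq_bot (α := Set X)).le
  top_le_sup_compl a := by
    induction a using ind with | _ s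
    exact mk_mono (s := ⊤) (t := s ⊔ sᶜ) (sup_compl_eq_top (α := Set X)).ge
  le_top a := by
    induction a using ind with | _ s
    exact mk_mono (t := ⊤) (subset_univ _)
  bot_le a := by
    induction a using ind with | _ s
    exact mk_mono (s := ⊥) (empty_subset _)

/-- The union of a countable family of measurable sets. -/
def cUnion (C : Set {s : Set X // MeasurableSet s}) (hC : C.Countable) :
    {s : Set X // MeasurableSet s} :=
  ⟨⋃ c ∈ C, (c : Set X), MeasurableSet.biUnion hC fun c _ => c.2⟩

theorem isLUB_cUnion (C : Set {s : Set X // MeasurableSet s}) (hC : C.Countable) :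
    IsLUB (mk N '' C) (mk N (cUnion C hC)) := by
  constructor
  · rintro _ ⟨c, hc, rfl⟩
    exact mk_mono (subset_biUnion_of_mem (u := fun c : {s : Set X // MeasurableSet s} => (c : Set X)) hc)
  · intro b hb
    induction b using ind with | _ t
    rw [mk_le]
    have h : ∀ c ∈ C, (c : Set X) \ t ∈ N := fun c hc => mk_le.1 (hb ⟨c, hc, rfl⟩)
    obtain ⟨μ, -, rfl⟩ := IsNegligibles.exists_measure (N := N)
    have e : ((cUnion C hC : {s : Set X // MeasurableSet s}) : Set X) \ t
        = ⋃ c ∈ C, ((c : Set X) \ t) := by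
      simp only [cUnion, iUnion_sdiff]
    rw [e]
    exact (measure_biUnion_null_iff hC).2 h

/-- Every subset of `𝓕/𝓝` has a least upper bound, attained by a countable subfamily. -/
theorem exists_countable_isLUB (S : Set (MeasAlg N)) :
    ∃ (C : Set {s : Set X // MeasurableSet s}) (hC : C.Countable),
      (∀ c ∈ C, mk N c ∈ S) ∧ IsLUB S (mk N (cUnion C hC)) := by
  obtain ⟨μ, hμ, hNμ⟩ := IsNegligibles.exists_measure (N := N)
  let R : Set ℝ≥0∞ := {r | ∃ (C : Set {s : Set X // MeasurableSet s}) (hC : C.Countable),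
    (∀ c ∈ C, mk N c ∈ S) ∧ r = μ (cUnion C hC : {s : Set X // MeasurableSet s})}
  have hR : R.Nonempty := ⟨_, ∅, countable_empty, by simp, rfl⟩
  obtain ⟨v, -, hv, hvR⟩ := exists_seq_tendsto_sSup hR (OrderTop.bddAbove R)
  choose C hC hCS hvC using hvR
  have hCc : (⋃ n, C n).Countable := countable_iUnion hC
  have hCS' : ∀ c ∈ ⋃ n, C n, mk N c ∈ S := by
    intro c hc
    obtain ⟨n, hn⟩ := mem_iUnion.1 hc
    exact hCS n c hn
  have hsup : sSup R ≤ μ (cUnion _ hCc : {s : Set X // MeasurableSet s}) := by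
    refine le_of_tendsto' hv fun n => ?_
    rw [hvC]
    exact measure_mono (biUnion_subset_biUnion_left (subset_iUnion C n))
  refine ⟨_, hCc, hCS', ?_, ?_⟩
  · intro a ha
    induction a using ind with | _ s
    rw [mk_le, hNμ]
    have hc : (insert s (⋃ n, C n)).Countable := hCc.insert s
    have h1 : μ (cUnion _ hc : {s : Set X // MeasurableSet s}) ≤ sSup R := by
      refine le_sSup ⟨_, hc, ?_, rfl⟩
      rintro c (rfl | h)
      exacts [ha, hCS' c h]
    have e : ((cUnion _ hc : {s : Set X // MeasurableSet s}) : Set X)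
        = ((cUnion _ hCc : {s : Set X // MeasurableSet s}) : Set X) ∪ ((s : Set X) \
          ((cUnion _ hCc : {s : Set X // MeasurableSet s}) : Set X)) := by
      rw [union_sdiff_self, union_comm]
      simp only [cUnion, biUnion_insert]
    rw [e, measure_union disjoint_sdiff_right (s.2.diff (cUnion _ hCc).2)] at h1
    have h2 := h1.trans hsup
    change μ _ = 0
    by_contra h0
    exact absurd h2 (not_le.2 (ENNReal.lt_add_right (measure_ne_top μ _) h0))
  · intro b hb
    refine (isLUB_cUnion (N := N) _ hCc).2 ?_
    rintro _ ⟨c, hc, rfl⟩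
    exact hb (hCS' c hc)

noncomputable instance : SupSet (MeasAlg N) where
  sSup S := mk N (cUnion _ (exists_countable_isLUB S).choose_spec.choose)

theorem isLUB_sSup' (S : Set (MeasAlg N)) : IsLUB S (sSup S) :=
  (exists_countable_isLUB S).choose_spec.choose_spec.2

noncomputable instance : CompleteBooleanAlgebra (MeasAlg N) where
  __ := (inferInstance : BooleanAlgebra (MeasAlg N))
  isLUB_sSup := isLUB_sSup'
  sInf S := sSup (lowerBounds S)
  isGLB_sInf _ := isLUB_lowerBounds.1 (isLUB_sSup' _)

theorem mk_compl (s : {s : Set X // MeasurableSet s}) : (mk N s)ᶜ = mk N sᶜ := rfl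

theorem mk_inf (s t : {s : Set X // MeasurableSet s}) : mk N s ⊓ mk N t = mk N (s ⊓ t) := rfl

theorem mk_bot : (⊥ : MeasAlg N) = mk N ⊥ := rfl

theorem mk_top : (⊤ : MeasAlg N) = mk N ⊤ := rfl

/-! The homomorphism induced by a map. -/

variable {Y : Type u} [MeasurableSpace Y] {M : Set (Set Y)} [IsNegligibles M]

/-- `[G] ↦ [f⁻¹ G]`, as a function. -/
def preimage (f : X → Y) (hf : Measurable f) (h : ∀ t ∈ M, f ⁻¹' t ∈ N) :
    MeasAlg M → MeasAlg N :=
  Quotient.map (fun s => ⟨f ⁻¹' (s : Set Y), hf s.2⟩) (by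
    intro s t hst
    exact h _ hst)

theorem preimage_mk (f : X → Y) (hf : Measurable f) (h : ∀ t ∈ M, f ⁻¹' t ∈ N)
    (s : {s : Set Y // MeasurableSet s}) :
    preimage f hf h (mk M s) = mk N ⟨f ⁻¹' (s : Set Y), hf s.2⟩ := rfl

theorem preimage_mono (f : X → Y) (hf : Measurable f) (h : ∀ t ∈ M, f ⁻¹' t ∈ N) :
    Monotone (preimage f hf h) := by
  intro a b
  induction a using ind with | _ s
  induction b using ind with | _ t
  rw [preimage_mk, preimage_mk, mk_le, mk_le]
  exact h _

theorem preimage_sSup (f : X → Y) (hf : Measurable f) (h : ∀ t ∈ M, f ⁻¹' t ∈ N)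
    (S : Set (MeasAlg M)) :
    preimage f hf h (sSup S) = sSup (preimage f hf h '' S) := by
  obtain ⟨C, hC, hCS, hl⟩ := exists_countable_isLUB S
  rw [(isLUB_sSup' S).unique hl]
  refine IsLUB.unique ⟨?_, ?_⟩ (isLUB_sSup' _)
  · rintro _ ⟨a, ha, rfl⟩
    exact preimage_mono f hf h (hl.1 ha)
  · intro b hb
    let g : {s : Set Y // MeasurableSet s} → {s : Set X // MeasurableSet s} :=
      fun s => ⟨f ⁻¹' (s : Set Y), hf s.2⟩
    have e : preimage f hf h (mk M (cUnion C hC)) = mk N (cUnion (g '' C) (hC.image g)) := by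
      rw [preimage_mk]
      congr 1
      apply Subtype.ext
      simp only [cUnion, g, biUnion_image, preimage_iUnion]
    rw [e]
    refine (isLUB_cUnion (N := N) _ (hC.image g)).2 ?_
    rintro _ ⟨_, ⟨c, hc, rfl⟩, rfl⟩
    exact hb ⟨mk M c, hCS c hc, rfl⟩

theorem preimage_compl (f : X → Y) (hf : Measurable f) (h : ∀ t ∈ M, f ⁻¹' t ∈ N)
    (a : MeasAlg M) : preimage f hf h aᶜ = (preimage f hf h a)ᶜ := by
  induction a using ind with | _ s
  rfl

/-- The complete Boolean algebra homomorphism `[G] ↦ [f⁻¹ G]`. -/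
def map (f : X → Y) (hf : Measurable f) (h : ∀ t ∈ M, f ⁻¹' t ∈ N) :
    CompleteLatticeHom (MeasAlg M) (MeasAlg N) where
  toFun := preimage f hf h
  map_sSup' := preimage_sSup f hf h
  map_sInf' S := by
    have e : sInf S = (sSup (compl '' S))ᶜ := by
      rw [compl_sSup', image_image]; simp
    rw [e, preimage_compl, preimage_sSup, compl_sSup', image_image, image_image]
    simp [preimage_compl]

theorem map_mk (f : X → Y) (hf : Measurable f) (h : ∀ t ∈ M, f ⁻¹' t ∈ N)
    (s : {s : Set Y // MeasurableSet s}) :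
    map f hf h (mk M s) = mk N ⟨f ⁻¹' (s : Set Y), hf s.2⟩ := rfl

theorem map_injective (f : X → Y) (hf : Measurable f) (h : ∀ t ∈ M, f ⁻¹' t ∈ N)
    (h' : ∀ t, MeasurableSet t → f ⁻¹' t ∈ N → t ∈ M) :
    Function.Injective (map f hf h) := by
  intro a b
  induction a using ind with | _ s
  induction b using ind with | _ t
  rw [map_mk, map_mk, mk_eq, mk_eq]
  exact h' _ (s.2.symmDiff t.2)

theorem map_congr {f g : X → Y} (hf : Measurable f) (hg : Measurable g)
    (h : ∀ t ∈ M, f ⁻¹' t ∈ N) (h' : ∀ t ∈ M, g ⁻¹' t ∈ N) (hfg : {x | f x ≠ g x} ∈ N) :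
    (map f hf h : CompleteLatticeHom (MeasAlg M) (MeasAlg N)) = map g hg h' := by
  ext a
  induction a using ind with | _ s
  rw [map_mk, map_mk, mk_eq]
  obtain ⟨μ, -, rfl⟩ := IsNegligibles.exists_measure (N := N)
  refine measure_mono_null ?_ hfg
  rintro x (⟨h1, h2⟩ | ⟨h1, h2⟩) h3
  · exact h2 (by change g x ∈ (s : Set _); rw [← h3]; exact h1)
  · exact h2 (by change f x ∈ (s : Set _); rw [h3]; exact h1)

/-- The functional `[F] ↦ μ F` on `𝓕/μ`. -/
def measure (μ : Measure X) [IsFiniteMeasure μ] : MeasAlg (negligibles μ) → ℝ≥0∞ :=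
  Quotient.lift (fun s => μ (s : Set X)) (by
    intro s t h
    change μ _ = 0 at h
    rw [measure_symmDiff_eq_zero_iff] at h
    exact measure_congr h)

theorem measure_mk (μ : Measure X) [IsFiniteMeasure μ] (s : {s : Set X // MeasurableSet s}) :
    measure μ (mk _ s) = μ (s : Set X) := rfl

end MeasAlg

end MeasAlg

/-! ### Probability algebras -/

/-- `μ` makes the complete Boolean algebra `A` a probability algebra. (The values of `μ` are
automatically in `[0,1]`.) -/
structure IsProbAlgMeasure {A : Type u} [CompleteBooleanAlgebra A] (μ : A → ℝ≥0∞) : Prop where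
  bot : μ ⊥ = 0
  pos : ∀ a, a ≠ ⊥ → 0 < μ a
  iSup : ∀ a : ℕ → A, (∀ i j, i ≠ j → a i ⊓ a j = ⊥) → μ (⨆ i, a i) = ∑' i, μ (a i)
  top : μ ⊤ = 1

theorem MeasAlg.isProbAlgMeasure {X : Type u} [MeasurableSpace X] (μ : Measure X)
    [IsProbabilityMeasure μ] : IsProbAlgMeasure (MeasAlg.measure μ) where
  bot := by rw [mk_bot, measure_mk]; exact measure_empty
  pos a := by
    induction a using ind with | _ s
    intro h
    rw [measure_mk, pos_iff_ne_zero]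
    intro h0
    apply h
    rw [mk_bot, mk_eq]
    change μ ((s : Set X) ∆ ∅) = 0
    rw [← bot_eq_empty, symmDiff_bot]
    exact h0
  iSup a hd := by
    choose s hs using fun i => Quotient.exists_rep (a i)
    change ∀ i, mk _ (s i) = a i at hs
    obtain rfl : a = fun i => mk _ (s i) := funext fun i => (hs i).symm
    have hl := isLUB_cUnion (N := negligibles μ) (range s) (countable_range s)
    rw [← range_comp] at hl
    have e := IsLUB.unique (isLUB_iSup (f := fun i => mk (negligibles μ) (s i))) hl
    rw [e, measure_mk]
    simp only [cUnion, biUnion_range, measure_mk]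
    refine measure_iUnion₀ ?_ fun i => (s i).2.nullMeasurableSet
    intro i j hij
    have := hd i j hij
    rw [mk_inf, mk_bot, mk_eq] at this
    change μ (((s i : Set X) ∩ s j) ∆ ∅) = 0 at this
    rwa [← bot_eq_empty, symmDiff_bot] at this
  top := by rw [mk_top, measure_mk]; exact measure_univ

/-- The two-element algebra whose top element has measure `q`. -/
def atomMeasure (q : ℝ≥0∞) (b : Bool) : ℝ≥0∞ := if b = true then q else 0

/-- Lebesgue measure on the interval `[0, p]`. -/
noncomputable def lebMeasure (p : ℝ) : Measure (Icc (0 : ℝ) p) :=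
  Measure.comap Subtype.val (volume : Measure ℝ)

instance (p : ℝ) : IsFiniteMeasure (lebMeasure p) :=
  ⟨by
    rw [lebMeasure, (MeasurableEmbedding.subtype_coe measurableSet_Icc).comap_apply,
      image_univ, Subtype.range_coe]
    exact measure_Icc_lt_top⟩

/-- The measure algebra of Lebesgue measure on `[0, p]`. (It does not matter that Borel sets modulo
null sets are used: every Lebesgue measurable set agrees with a Borel set up to a null set.) -/
abbrev LebAlg (p : ℝ) : Type := MeasAlg (negligibles (lebMeasure p))

/-- `(A, μ)` is composed of at most countably many atoms and possibly an interval: it is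
isomorphic either to the simple product of the algebra of Lebesgue measure on `[0, p]`,
`0 < p ≤ 1`, with countably many two-element algebras of weights `q i > 0`, or to the simple
product of the latter alone. Operations in a simple product are pointwise, its measure is the sum
of the measures of the components. -/
def IsStdAlgMeasure {A : Type u} [CompleteBooleanAlgebra A] (μ : A → ℝ≥0∞) : Prop :=
  ∃ (I : Type) (_ : Countable I) (q : I → ℝ≥0∞), (∀ i, 0 < q i) ∧
    ((∃ p : ℝ, 0 < p ∧ p ≤ 1 ∧ ∃ e : A ≃o LebAlg p × (I → Bool),
        ∀ a, μ a = MeasAlg.measure (lebMeasure p) (e a).1 + ∑' i, atomMeasure (q i) ((e a).2 i)) ∨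
      ∃ e : A ≃o (I → Bool), ∀ a, μ a = ∑' i, atomMeasure (q i) (e a i))

/-- A probability algebra. -/
structure ProbAlg : Type (u + 1) where
  carrier : Type u
  [cba : CompleteBooleanAlgebra carrier]
  μ : carrier → ℝ≥0∞
  isProb : IsProbAlgMeasure μ

attribute [instance] ProbAlg.cba

/-- Morphisms are the measure-preserving complete Boolean algebra homomorphisms. -/
instance : Category.{u} ProbAlg.{u} where
  Hom A B := {f : CompleteLatticeHom A.carrier B.carrier // ∀ a, B.μ (f a) = A.μ a}
  id A := ⟨CompleteLatticeHom.id A.carrier, fun _ => rfl⟩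
  comp f g := ⟨g.1.comp f.1, fun a => (g.2 (f.1 a)).trans (f.2 a)⟩

/-- A probability algebra is standard. -/
def ProbAlg.IsStandard : ObjectProperty ProbAlg.{u} := fun A => IsStdAlgMeasure A.μ

/-- The category of standard probability algebras and measure algebra homomorphisms. -/
abbrev StdProbAlg : Type (u + 1) := ProbAlg.IsStandard.{u}.FullSubcategory

/-- A measurable algebra: a complete Boolean algebra that carries some measure making it a
probability algebra. -/
structure MbleAlg : Type (u + 1) where
  carrier : Type u
  [cba : CompleteBooleanAlgebra carrier]
  exists_measure : ∃ μ : carrier → ℝ≥0∞, IsProbAlgMeasure μ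

attribute [instance] MbleAlg.cba

/-- Morphisms are the injective complete Boolean algebra homomorphisms. -/
instance : Category.{u} MbleAlg.{u} where
  Hom A B := {f : CompleteLatticeHom A.carrier B.carrier // Function.Injective f}
  id A := ⟨CompleteLatticeHom.id A.carrier, fun _ _ h => h⟩
  comp f g := ⟨g.1.comp f.1, fun _ _ h => f.2 (g.2 h)⟩

/-- A measurable algebra is standard when some measure on it makes it a standard probability
algebra. -/
def MbleAlg.IsStandard : ObjectProperty MbleAlg.{u} := fun A =>
  ∃ μ : A.carrier → ℝ≥0∞, IsProbAlgMeasure μ ∧ IsStdAlgMeasure μ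

/-- The category of standard measurable algebras and injective complete homomorphisms. -/
abbrev StdMbleAlg : Type (u + 1) := MbleAlg.IsStandard.{u}.FullSubcategory

/-! ### The category of standard probability spaces -/

/-- A standard probability space. -/
structure StdProb : Type (u + 1) where
  carrier : Type u
  [ms : MeasurableSpace carrier]
  μ : Measure carrier
  std : IsStdProbSpace μ

namespace StdProb

attribute [instance] StdProb.ms

instance (X : StdProb.{u}) : IsProbabilityMeasure X.μ := X.std.isProb

/-- Almost-sure equality of measure-preserving maps. -/
def homSetoid (X Y : StdProb.{u}) :
    Setoid {f : X.carrier → Y.carrier // MeasurePreserving f X.μ Y.μ} where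
  r f g := X.μ {x | f.1 x ≠ g.1 x} = 0
  iseqv := ⟨fun f => show f.1 =ᵐ[X.μ] f.1 from Filter.EventuallyEq.rfl,
    fun {f g} (h : f.1 =ᵐ[X.μ] g.1) => h.symm,
    fun {f g k} (h : f.1 =ᵐ[X.μ] g.1) (h' : g.1 =ᵐ[X.μ] k.1) => h.trans h'⟩

/-- Morphisms are measure-preserving maps modulo almost-sure equality. -/
instance : Category.{u} StdProb.{u} where
  Hom X Y := Quotient (homSetoid X Y)
  id X := Quotient.mk _ ⟨id, MeasurePreserving.id X.μ⟩
  comp {X Y Z} := Quotient.map₂ (fun f g => ⟨g.1 ∘ f.1, g.2.comp f.2⟩) (by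
    rintro ⟨f, hf⟩ ⟨f', hf'⟩ h ⟨g, hg⟩ ⟨g', hg'⟩ h'
    change f =ᵐ[X.μ] f' at h
    change g =ᵐ[Y.μ] g' at h'
    change (g ∘ f) =ᵐ[X.μ] (g' ∘ f')
    exact (hf.quasiMeasurePreserving.ae_eq_comp h').trans (h.fun_comp g'))
  id_comp := by rintro X Y ⟨f⟩; rfl
  comp_id := by rintro X Y ⟨f⟩; rfl
  assoc := by rintro X Y Z W ⟨f⟩ ⟨g⟩ ⟨h⟩; rfl

theorem preimage_null {X Y : StdProb.{u}} {f : X.carrier → Y.carrier}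
    (hf : MeasurePreserving f X.μ Y.μ) :
    ∀ t ∈ negligibles Y.μ, f ⁻¹' t ∈ negligibles X.μ :=
  fun _ ht => hf.quasiMeasurePreserving.preimage_null ht

/-- The contravariant functor `(X, 𝓕, μ) ↦ (𝓕/μ, μ)`, `[f] ↦ ([G] ↦ [f⁻¹ G])` from standard
probability spaces to probability algebras. -/
noncomputable def measAlg : StdProb.{u}ᵒᵖ ⥤ ProbAlg.{u} where
  obj X :=
    { carrier := MeasAlg (negligibles X.unop.μ)
      μ := MeasAlg.measure X.unop.μ
      isProb := MeasAlg.isProbAlgMeasure X.unop.μ }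
  map {Y X} f := Quotient.lift
    (fun f : {f : X.unop.carrier → Y.unop.carrier // MeasurePreserving f X.unop.μ Y.unop.μ} =>
      (⟨MeasAlg.map f.1 f.2.measurable (preimage_null f.2), by
        intro a
        induction a using MeasAlg.ind with | _ s
        exact f.2.measure_preimage s.2.nullMeasurableSet⟩ :
        {g : CompleteLatticeHom (MeasAlg (negligibles Y.unop.μ)) (MeasAlg (negligibles X.unop.μ)) //
          ∀ a, MeasAlg.measure X.unop.μ (g a) = MeasAlg.measure Y.unop.μ a}))
    (fun f g h => Subtype.ext (MeasAlg.map_congr _ _ _ _ h)) f.unop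
  map_id X := by
    apply Subtype.ext
    apply CompleteLatticeHom.ext
    intro a
    induction a using MeasAlg.ind with | _ s
    rfl
  map_comp := by
    rintro ⟨X⟩ ⟨Y⟩ ⟨Z⟩ ⟨⟨f⟩⟩ ⟨⟨g⟩⟩
    apply Subtype.ext
    apply CompleteLatticeHom.ext
    intro a
    induction a using MeasAlg.ind with | _ s
    rfl

end StdProb

/-! ### The category of standard enhanced measurable spaces -/

/-- A standard enhanced measurable space `(X, 𝓕, 𝓝)`: some measure with negligible sets `𝓝` makes
`(X, 𝓕)` a standard probability space. (Such a measure is complete, so that all its null sets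
lie in `𝓕`.) -/
structure StdMble : Type (u + 1) where
  carrier : Type u
  [ms : MeasurableSpace carrier]
  null : Set (Set carrier)
  std : ∃ μ : Measure carrier, IsStdProbSpace μ ∧ null = negligibles μ

namespace StdMble

attribute [instance] StdMble.ms

instance (X : StdMble.{u}) : IsNegligibles X.null := by
  obtain ⟨μ, h, e⟩ := X.std
  have := h.isProb
  exact ⟨μ, inferInstance, e⟩

/-- A measurable map that reflects and preserves negligible sets. -/
structure IsMap (X Y : StdMble.{u}) (f : X.carrier → Y.carrier) : Prop where
  measurable : Measurable f
  reflecting : ∀ M ∈ Y.null, f ⁻¹' M ∈ X.null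
  preserving : ∀ G, MeasurableSet G → f ⁻¹' G ∈ X.null → G ∈ Y.null

/-- Almost-sure equality of maps. -/
def homSetoid (X Y : StdMble.{u}) : Setoid {f : X.carrier → Y.carrier // IsMap X Y f} where
  r f g := {x | f.1 x ≠ g.1 x} ∈ X.null
  iseqv := by
    obtain ⟨μ, -, e⟩ := X.std
    rw [e]
    exact ⟨fun f => show f.1 =ᵐ[μ] f.1 from Filter.EventuallyEq.rfl,
      fun {f g} (h : f.1 =ᵐ[μ] g.1) => h.symm,
      fun {f g k} (h : f.1 =ᵐ[μ] g.1) (h' : g.1 =ᵐ[μ] k.1) => h.trans h'⟩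

/-- Morphisms are the negligible-preserving and -reflecting measurable maps modulo almost-sure
equality. -/
instance : Category.{u} StdMble.{u} where
  Hom X Y := Quotient (homSetoid X Y)
  id X := Quotient.mk _ ⟨id, measurable_id, fun _ h => h, fun _ _ h => h⟩
  comp {X Y Z} := Quotient.map₂
    (fun f g => ⟨g.1 ∘ f.1, g.2.measurable.comp f.2.measurable,
      fun M hM => f.2.reflecting _ (g.2.reflecting _ hM),
      fun G hG h => g.2.preserving _ hG (f.2.preserving _ (g.2.measurable hG) h)⟩) (by
    rintro ⟨f, hf⟩ ⟨f', hf'⟩ h ⟨g, hg⟩ ⟨g', hg'⟩ h'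
    change {x | f x ≠ f' x} ∈ X.null at h
    have h'' := hf.reflecting {y | g y ≠ g' y} h'
    change {x | g (f x) ≠ g' (f' x)} ∈ X.null
    obtain ⟨μ, -, e⟩ := X.std
    rw [e] at h h'' ⊢
    refine measure_mono_null ?_ (measure_union_null h h'')
    intro x hx
    by_cases hfx : f x = f' x
    · right
      change g (f x) ≠ g' (f x)
      change g (f x) ≠ g' (f' x) at hx
      rwa [← hfx] at hx
    · exact Or.inl hfx)
  id_comp := by rintro X Y ⟨f⟩; rfl
  comp_id := by rintro X Y ⟨f⟩; rfl
  assoc := by rintro X Y Z W ⟨f⟩ ⟨g⟩ ⟨h⟩; rfl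

/-- The contravariant functor `(X, 𝓕, 𝓝) ↦ 𝓕/𝓝`, `[f] ↦ ([G] ↦ [f⁻¹ G])` from standard enhanced
measurable spaces to measurable algebras. -/
noncomputable def measAlg : StdMble.{u}ᵒᵖ ⥤ MbleAlg.{u} where
  obj X :=
    { carrier := MeasAlg X.unop.null
      exists_measure := by
        obtain ⟨⟨X, N, μ, hμ, rfl⟩⟩ := X
        have := hμ.isProb
        exact ⟨MeasAlg.measure μ, MeasAlg.isProbAlgMeasure μ⟩ }
  map {Y X} f := Quotient.lift
    (fun f : {f : X.unop.carrier → Y.unop.carrier // IsMap X.unop Y.unop f} =>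
      (⟨MeasAlg.map f.1 f.2.measurable f.2.reflecting,
        MeasAlg.map_injective f.1 f.2.measurable f.2.reflecting f.2.preserving⟩ :
        {g : CompleteLatticeHom (MeasAlg Y.unop.null) (MeasAlg X.unop.null) //
          Function.Injective g}))
    (fun f g h => Subtype.ext (MeasAlg.map_congr _ _ _ _ h)) f.unop
  map_id X := by
    apply Subtype.ext
    apply CompleteLatticeHom.ext
    intro a
    induction a using MeasAlg.ind with | _ s
    rfl
  map_comp := by
    rintro ⟨X⟩ ⟨Y⟩ ⟨Z⟩ ⟨⟨f⟩⟩ ⟨⟨g⟩⟩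
    apply Subtype.ext
    apply CompleteLatticeHom.ext
    intro a
    induction a using MeasAlg.ind with | _ s
    rfl

end StdMble

/-! Both functors are shown to be full, faithful and essentially surjective, and to land in the
standard algebras. The measurable and the probabilistic case share all the analysis.

Full faithfulness rests on coding a standard space `Y` by an injection `ι` into the Cantor space,
that is, by a sequence of measurable sets `E n` separating points. If `f` and `g` induce the same
homomorphism, the preimages of each `E n` differ by a null set, so `f` and `g` agree off a countable
union of null sets (`MeasAlg.ae_eq_of_map_eq`). Conversely, given `φ`, representatives of the
classes `φ [E n]` are the coordinates of a map into the Cantor space; it induces `φ` on Borel sets,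
hence almost surely hits the Borel set `range ι`, and composing with the inverse of `ι` gives the
required map (`MeasAlg.exists_map_eq`). Only completeness of the source is used there, and `φ` need
be neither injective nor measure-preserving; these properties of `φ` turn into the corresponding
properties of the map.

The objects are compared through a model: an interval with Lebesgue measure together with countably
many weighted points. The algebra of the model is the simple product in the definition of a standard
algebra (`exists_orderIso_modelMeasure`), so its completion realizes any given standard algebra
(`IsStdAlgMeasure.exists_stdProb`). In the other direction, a standard probability space is carried
to a Borel measure on the line; its atoms are split off, and the distribution function of the rest
maps it to Lebesgue measure on an interval (`exists_isMeasAlgIso_modelMeasure`). No invertible point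
map is needed: it is enough that every measurable set is almost a preimage, which is what
`IsMeasAlgIso` records. -/

namespace MeasAlg

/-- A surjection from the measurable sets onto a partial order that is monotone and
order-reflecting modulo negligible sets descends to an order isomorphism. -/
theorem exists_orderIso {X P : Type*} [MeasurableSpace X] [PartialOrder P] (N : Set (Set X))
    [IsNegligibles N] (g : {s : Set X // MeasurableSet s} → P)
    (hg : ∀ s t, g s ≤ g t ↔ (s : Set X) \ t ∈ N) (hs : Function.Surjective g) :
    ∃ e : MeasAlg N ≃o P, ∀ s, e (mk N s) = g s := by
  have hle : ∀ s t, mk N s ≤ mk N t ↔ g s ≤ g t := fun s t => mk_le.trans (hg s t).symm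
  let φ : MeasAlg N → P := Quotient.lift g fun s t h =>
    have h : mk N s = mk N t := mk_eq.2 h
    le_antisymm ((hle s t).1 h.le) ((hle t s).1 h.ge)
  have hφ : ∀ a b, φ a ≤ φ b ↔ a ≤ b := by
    intro a b
    induction a using ind with | _ s
    induction b using ind with | _ t
    exact (hle s t).symm
  exact ⟨RelIso.ofSurjective (OrderEmbedding.ofMapLEIff φ hφ)
    fun p => (hs p).imp' (mk N) fun s h => h, fun s => rfl⟩

end MeasAlg

/-! ### Maps inducing isomorphisms of measure algebras -/

/-- A measure-preserving map for which every measurable set of the source is almost everywhere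
equal to the preimage of a measurable set of the target. -/
structure IsMeasAlgIso {X Y : Type*} [MeasurableSpace X] [MeasurableSpace Y] (f : X → Y)
    (μ : Measure X) (ν : Measure Y) : Prop where
  measurePreserving : MeasurePreserving f μ ν
  exists_ae_eq : ∀ s, MeasurableSet s → ∃ t, MeasurableSet t ∧ f ⁻¹' t =ᵐ[μ] s

namespace IsMeasAlgIso

variable {X Y Z : Type*} [MeasurableSpace X] [MeasurableSpace Y] [MeasurableSpace Z]
  {μ : Measure X} {ν : Measure Y} {ρ : Measure Z} {f : X → Y} {g : Y → Z}

theorem comp (hg : IsMeasAlgIso g ν ρ) (hf : IsMeasAlgIso f μ ν) : IsMeasAlgIso (g ∘ f) μ ρ where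
  measurePreserving := hg.measurePreserving.comp hf.measurePreserving
  exists_ae_eq s hs := by
    obtain ⟨t, ht, hts⟩ := hf.exists_ae_eq s hs
    obtain ⟨r, hr, hrt⟩ := hg.exists_ae_eq t ht
    exact ⟨r, hr, (hf.measurePreserving.quasiMeasurePreserving.preimage_ae_eq hrt).trans hts⟩

theorem _root_.MeasurableEmbedding.isMeasAlgIso (hf : MeasurableEmbedding f) (μ : Measure X) :
    IsMeasAlgIso f μ (μ.map f) where
  measurePreserving := hf.measurable.measurePreserving μ
  exists_ae_eq s hs := ⟨f '' s, hf.measurableSet_image.2 hs, by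
    rw [preimage_image_eq s hf.injective]; exact .rfl⟩

theorem isProbabilityMeasure [IsProbabilityMeasure μ] (hf : IsMeasAlgIso f μ ν) :
    IsProbabilityMeasure ν :=
  hf.measurePreserving.map_eq ▸ Measure.isProbabilityMeasure_map hf.measurePreserving.aemeasurable

/-- Taking preimages reflects the order because it preserves the measure of `s \ t`, and it is onto
by `exists_ae_eq`. -/
theorem exists_orderIso [IsFiniteMeasure μ] [IsFiniteMeasure ν] (hf : IsMeasAlgIso f μ ν) :
    ∃ e : MeasAlg (negligibles ν) ≃o MeasAlg (negligibles μ),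
      ∀ a, MeasAlg.measure μ (e a) = MeasAlg.measure ν a := by
  have hm := hf.measurePreserving
  obtain ⟨e, he⟩ := MeasAlg.exists_orderIso (negligibles ν)
    (fun s => MeasAlg.mk (negligibles μ) ⟨f ⁻¹' s, hm.measurable s.2⟩) (by
      intro s t
      rw [MeasAlg.mk_le]
      change μ (f ⁻¹' ((s : Set Y) \ t)) = 0 ↔ ν ((s : Set Y) \ t) = 0
      rw [hm.measure_preimage (s.2.diff t.2).nullMeasurableSet]) (by
      intro a
      induction a using MeasAlg.ind with | _ s
      obtain ⟨t, ht, hts⟩ := hf.exists_ae_eq s s.2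
      exact ⟨⟨t, ht⟩, MeasAlg.mk_eq.2 (measure_symmDiff_eq_zero_iff.2 hts)⟩)
  refine ⟨e, fun a => ?_⟩
  induction a using MeasAlg.ind with | _ s
  rw [he]
  exact hm.measure_preimage s.2.nullMeasurableSet

end IsMeasAlgIso

/-! ### Transfer of the standard Borel property -/

theorem MeasurableEquiv.standardBorelSpace {X Y : Type*} [MeasurableSpace X] [MeasurableSpace Y]
    [StandardBorelSpace Y] (e : X ≃ᵐ Y) : StandardBorelSpace X := by
  let _ := upgradeStandardBorel Y
  let _ : TopologicalSpace X := .induced e inferInstance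
  have : PolishSpace X := e.toEquiv.polishSpace_induced
  have : BorelSpace X := ⟨by
    rw [borel_comap, ← BorelSpace.measurable_eq]
    exact e.measurableEmbedding.comap_eq.symm⟩
  infer_instance

theorem MeasurableEmbedding.standardBorelSpace {X Y : Type*} [MeasurableSpace X]
    [MeasurableSpace Y] [StandardBorelSpace Y] {f : X → Y} (hf : MeasurableEmbedding f) :
    StandardBorelSpace X :=
  have := hf.measurableSet_range.standardBorel
  hf.equivRange.standardBorelSpace

/-! ### The model: an interval together with countably many atoms -/

/-- The measure on the disjoint union of `[0, p]` and a set `I` which is Lebesgue measure on the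
interval and gives weight `q i` to the point `i`. -/
noncomputable def modelMeasure {I : Type*} [MeasurableSpace I] (p : ℝ) (q : I → ℝ≥0∞) :
    Measure (Icc (0 : ℝ) p ⊕ I) :=
  (lebMeasure p).map Sum.inl + (Measure.sum fun i => q i • Measure.dirac i).map Sum.inr

section Model

variable {I : Type*} [MeasurableSpace I] {p : ℝ} {q : I → ℝ≥0∞}

theorem modelMeasure_apply {s : Set (Icc (0 : ℝ) p ⊕ I)} (hs : MeasurableSet s) :
    modelMeasure p q s
      = lebMeasure p (Sum.inl ⁻¹' s) + ∑' i, q i * (Sum.inr ⁻¹' s).indicator 1 i := by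
  rw [modelMeasure, Measure.add_apply, Measure.map_apply measurable_inl hs,
    Measure.map_apply measurable_inr hs, Measure.sum_apply _ (measurable_inr hs)]
  congr 2 with i
  rw [Measure.smul_apply, Measure.dirac_apply' _ (measurable_inr hs), smul_eq_mul]

theorem modelMeasure_univ :
    modelMeasure p q univ = MeasAlg.measure (lebMeasure p) ⊤ + ∑' i, atomMeasure (q i) true := by
  rw [modelMeasure_apply MeasurableSet.univ]
  simp [atomMeasure, MeasAlg.mk_top, MeasAlg.measure_mk]

/-- Since all weights are positive, a null set contains no point of `I`. The discrete part is
therefore not affected by the quotient and contributes the full power set of `I`. -/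
theorem exists_orderIso_modelMeasure [DiscreteMeasurableSpace I]
    (hq : ∀ i, 0 < q i) [IsFiniteMeasure (modelMeasure p q)] :
    ∃ e : MeasAlg (negligibles (modelMeasure p q)) ≃o LebAlg p × (I → Bool),
      ∀ a, MeasAlg.measure (modelMeasure p q) a
        = MeasAlg.measure (lebMeasure p) (e a).1 + ∑' i, atomMeasure (q i) ((e a).2 i) := by
  classical
  let g : {s : Set (Icc (0 : ℝ) p ⊕ I) // MeasurableSet s} → LebAlg p × (I → Bool) := fun s =>
    (MeasAlg.mk _ ⟨Sum.inl ⁻¹' (s : Set (Icc (0 : ℝ) p ⊕ I)), measurable_inl s.2⟩,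
      fun i => decide (Sum.inr i ∈ (s : Set (Icc (0 : ℝ) p ⊕ I))))
  have hg : ∀ s i, (g s).2 i = decide (Sum.inr i ∈ (s : Set (Icc (0 : ℝ) p ⊕ I))) :=
    fun _ _ => rfl
  obtain ⟨e, he⟩ := MeasAlg.exists_orderIso (negligibles (modelMeasure p q)) g (by
      intro s t
      rw [Prod.mk_le_mk, MeasAlg.mk_le]
      change lebMeasure p (Sum.inl ⁻¹' ((s : Set (Icc (0 : ℝ) p ⊕ I)) \ t)) = 0 ∧ _ ↔
        modelMeasure p q _ = 0
      rw [modelMeasure_apply (s.2.diff t.2), add_eq_zero, ENNReal.tsum_eq_zero]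
      refine and_congr_right' (forall_congr' fun i => ?_)
      simp [(hq i).ne', Bool.le_iff_imp]) (by
      rintro ⟨a, b⟩
      induction a using MeasAlg.ind with | _ s
      have hs : MeasurableSet (Sum.inl '' (s : Set _) ∪ Sum.inr '' {i | b i = true}
          : Set (Icc (0 : ℝ) p ⊕ I)) :=
        (measurableSet_inl_image.2 s.2).union (measurableSet_inr_image.2 .of_discrete)
      refine ⟨⟨_, hs⟩, ?_⟩
      refine Prod.ext (congrArg (MeasAlg.mk _) (Subtype.ext ?_)) (funext fun i => ?_)
      · ext x
        simp
      · simp [hg])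
  refine ⟨e, fun a => ?_⟩
  induction a using MeasAlg.ind with | _ s
  rw [he, MeasAlg.measure_mk, modelMeasure_apply s.2]
  congr 2 with i
  by_cases h : Sum.inr i ∈ (s : Set (Icc (0 : ℝ) p ⊕ I)) <;> simp [h, hg, atomMeasure]

instance [Countable I] [DiscreteMeasurableSpace I] :
    StandardBorelSpace (ULift.{u} (Icc (0 : ℝ) p ⊕ I)) := by
  obtain ⟨n, hn⟩ := exists_injective_nat I
  -- The interval sits at level `0`; the shift by one keeps the points of `I` away from it.
  let f : Icc (0 : ℝ) p ⊕ I → ℝ × ℕ := Sum.elim (fun x => (x, 0)) fun i => (0, n i + 1)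
  have hf : MeasurableEmbedding f := by
    refine ⟨?_, Measurable.sumElim (by fun_prop) (by fun_prop), fun s hs => ?_⟩
    · rintro (x | i) (y | j) h <;> simp [f, Subtype.ext_iff, hn.eq_iff] at h ⊢ <;> exact h
    · obtain ⟨h1, h2⟩ := measurableSet_sum_iff.1 hs
      have e : f '' s = ((↑) '' (Sum.inl ⁻¹' s)) ×ˢ {0} ∪
          ({0} : Set ℝ) ×ˢ ((fun i => n i + 1) '' (Sum.inr ⁻¹' s)) := by
        ext ⟨x, k⟩
        simp [f]
        grind
      rw [e]
      exact (((MeasurableEmbedding.subtype_coe measurableSet_Icc).measurableSet_image.2 h1).prod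
        (measurableSet_singleton 0)).union ((measurableSet_singleton 0).prod .of_discrete)
  exact (hf.comp MeasurableEquiv.ulift.measurableEmbedding).standardBorelSpace

end Model

instance : Subsingleton (LebAlg 0) := by
  refine ⟨fun a b => ?_⟩
  induction a using MeasAlg.ind with | _ s
  induction b using MeasAlg.ind with | _ t
  rw [MeasAlg.mk_eq]
  refine measure_mono_null (subset_univ _) ?_
  rw [lebMeasure, (MeasurableEmbedding.subtype_coe measurableSet_Icc).comap_apply]
  simp

/-- The algebra `LebAlg 0` is trivial, so allowing `p = 0` absorbs the purely atomic case. -/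
theorem isStdAlgMeasure_iff {A : Type u} [CompleteBooleanAlgebra A] {μ : A → ℝ≥0∞} :
    IsStdAlgMeasure μ ↔ ∃ (I : Type) (_ : Countable I) (q : I → ℝ≥0∞), (∀ i, 0 < q i) ∧
      ∃ p : ℝ, 0 ≤ p ∧ p ≤ 1 ∧ ∃ e : A ≃o LebAlg p × (I → Bool),
        ∀ a, μ a = MeasAlg.measure (lebMeasure p) (e a).1
          + ∑' i, atomMeasure (q i) ((e a).2 i) := by
  have h0 : ∀ a, MeasAlg.measure (lebMeasure 0) a = 0 := fun a => by
    rw [Subsingleton.elim a ⊥, MeasAlg.mk_bot, MeasAlg.measure_mk]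
    exact measure_empty
  constructor
  · rintro ⟨I, hI, q, hq, ⟨p, hp, hp1, e, he⟩ | ⟨e, he⟩⟩
    · exact ⟨I, hI, q, hq, p, hp.le, hp1, e, he⟩
    · refine ⟨I, hI, q, hq, 0, le_rfl, zero_le_one, e.trans
        ⟨⟨fun b => (⊥, b), Prod.snd, fun _ => rfl, fun _ => Prod.ext (Subsingleton.elim _ _) rfl⟩,
          by simp⟩, fun a => ?_⟩
      rw [h0, zero_add]
      exact he a
  · rintro ⟨I, hI, q, hq, p, hp, hp1, e, he⟩
    refine ⟨I, hI, q, hq, ?_⟩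
    rcases hp.eq_or_lt with rfl | hp
    · refine .inr ⟨e.trans
        ⟨⟨Prod.snd, fun b => (⊥, b), fun _ => Prod.ext (Subsingleton.elim _ _) rfl, fun _ => rfl⟩,
          ?_⟩, fun a => ?_⟩
      · intro a b
        exact ⟨fun h => ⟨(Subsingleton.elim _ _).le, h⟩, fun h => h.2⟩
      · rw [he, h0, zero_add]
        rfl
    · exact .inl ⟨p, hp, hp1, e, he⟩

/-! ### Borel probability measures on the real line -/

section RealLine

variable (μ : Measure ℝ) [IsFiniteMeasure μ]

theorem monotone_measureReal_Iic : Monotone fun t => μ.real (Iic t) :=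
  fun _ _ h => measureReal_mono (Iic_subset_Iic.2 h)

theorem continuous_measureReal_Iic [NullSingletonClass μ] : Continuous fun t => μ.real (Iic t) := by
  -- Up to a constant, the distribution function is a primitive of `1` with respect to `μ`, which is
  -- continuous when points are null.
  have h := ((integrable_const (1 : ℝ)).continuous_primitive (μ := μ) 0).add
    (continuous_const (y := μ.real (Iic 0)))
  convert h with t
  rw [Pi.add_apply, ← intervalIntegral.integral_Iic_sub_Iic (by simp) (by simp)]
  simp

theorem tendsto_measureReal_Iic_atTop :
    Filter.Tendsto (fun t => μ.real (Iic t)) Filter.atTop (nhds (μ.real univ)) :=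
  (ENNReal.tendsto_toReal (measure_ne_top μ _)).comp (tendsto_measure_Iic_atTop μ)

theorem tendsto_measureReal_Iic_atBot :
    Filter.Tendsto (fun t => μ.real (Iic t)) Filter.atBot (nhds 0) := by
  have h := tendsto_measure_iInter_atBot (μ := μ) (s := fun t : ℝ => Iic t)
    (fun i => measurableSet_Iic.nullMeasurableSet) (fun _ _ h => Iic_subset_Iic.2 h)
    ⟨0, measure_ne_top μ _⟩
  rw [iInter_Iic_eq_empty_iff.2 (by simp [not_bddBelow_univ]), measure_empty] at h
  exact (ENNReal.tendsto_toReal ENNReal.zero_ne_top).comp h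

/-- The distribution function of an atomless measure takes values at most `c` on a set of
measure `c`. -/
theorem measureReal_setOf_measureReal_Iic_le [NullSingletonClass μ] {c : ℝ} (h0 : 0 < c)
    (hc : c < μ.real univ) : μ.real {s | μ.real (Iic s) ≤ c} = c := by
  obtain ⟨t₁, h₁⟩ := ((tendsto_measureReal_Iic_atBot μ).eventually_lt_const h0).exists
  obtain ⟨t₂, h₂⟩ := ((tendsto_measureReal_Iic_atTop μ).eventually_const_lt hc).exists
  set S := {s | μ.real (Iic s) ≤ c} with hS
  have hcl : IsClosed S := isClosed_le (continuous_measureReal_Iic μ) continuous_const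
  have hbdd : BddAbove S := ⟨t₂, fun s hs => le_of_lt
    ((monotone_measureReal_Iic μ).reflect_lt (lt_of_le_of_lt hs h₂))⟩
  have hmem : sSup S ∈ S := hcl.csSup_mem ⟨t₁, h₁.le⟩ hbdd
  have hSI : S = Iic (sSup S) := by
    ext s
    exact ⟨fun hs => le_csSup hbdd hs, fun hs => (monotone_measureReal_Iic μ hs).trans hmem⟩
  -- By the intermediate value theorem the value `c` is attained at some `t`, and `t ≤ sSup S` gives
  -- the lower bound.
  obtain ⟨t, ht⟩ := mem_range_of_exists_le_of_exists_ge (continuous_measureReal_Iic μ)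
    ⟨t₁, h₁.le⟩ ⟨t₂, h₂.le⟩
  rw [hSI]
  refine le_antisymm hmem ?_
  calc c = μ.real (Iic t) := ht.symm
    _ ≤ _ := monotone_measureReal_Iic μ (le_csSup hbdd ht.le)

/-- The two measures are compared on rays `Iic c`. The case of `c` strictly between `0` and the
total mass is `measureReal_setOf_measureReal_Iic_le`; the other two are degenerate. -/
theorem map_measureReal_Iic [NullSingletonClass μ] :
    μ.map (fun t => μ.real (Iic t)) = volume.restrict (Icc 0 (μ.real univ)) := by
  have hm := (continuous_measureReal_Iic μ).measurable
  refine Measure.ext_of_Iic _ _ fun c => ?_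
  rw [Measure.map_apply hm measurableSet_Iic, Measure.restrict_apply measurableSet_Iic]
  change μ {s | μ.real (Iic s) ≤ c} = _
  rcases lt_or_ge c (μ.real univ) with hc | hc
  · rcases lt_or_ge 0 c with h0 | h0
    · rw [← ofReal_measureReal, measureReal_setOf_measureReal_Iic_le μ h0 hc,
        show Iic c ∩ Icc 0 (μ.real univ) = Icc 0 c by ext; simp; grind, Real.volume_Icc, sub_zero]
    · have h1 : volume (Iic c ∩ Icc 0 (μ.real univ)) = 0 :=
        measure_mono_null (t := {0}) (fun x hx => le_antisymm (hx.1.trans h0) hx.2.1) (by simp)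
      rw [h1]
      rcases measureReal_nonneg (μ := μ) (s := univ) |>.eq_or_lt with h | h
      · exact measure_mono_null (subset_univ _) ((measureReal_eq_zero_iff).1 h.symm)
      · rw [← measureReal_eq_zero_iff]
        -- For `c ≤ 0` the sublevel set lies in those at small positive levels; the minimum with
        -- half the total mass keeps the level in the range of the lemma.
        refine le_antisymm (le_of_forall_pos_le_add fun ε hε => ?_) measureReal_nonneg
        have h2 : 0 < min ε (μ.real univ / 2) := by positivity
        have h3 := measureReal_setOf_measureReal_Iic_le μ h2
          ((min_le_right _ _).trans_lt (by linarith))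
        have h4 : μ.real {s | μ.real (Iic s) ≤ c} ≤
            μ.real {s | μ.real (Iic s) ≤ min ε (μ.real univ / 2)} :=
          measureReal_mono fun s hs => le_trans hs (h0.trans h2.le)
        rw [zero_add]
        exact h4.trans (h3.le.trans (min_le_left _ _))
  · rw [show {s | μ.real (Iic s) ≤ c} = univ from
      eq_univ_of_forall fun s => (measureReal_mono (subset_univ _)).trans hc,
      inter_eq_right.2 (fun x hx => hx.2.trans hc), Real.volume_Icc, sub_zero, ofReal_measureReal]

/-- The distribution function of an atomless measure pushes it to Lebesgue measure on an
interval. -/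
theorem measurePreserving_of_coe_eq_measureReal_Iic [NullSingletonClass μ]
    {G : ℝ → Icc 0 (μ.real univ)} (hG : ∀ t, (G t : ℝ) = μ.real (Iic t)) :
    MeasurePreserving G μ (lebMeasure (μ.real univ)) := by
  have hc : Subtype.val ∘ G = fun t => μ.real (Iic t) := funext hG
  have hm : Measurable G := Measurable.subtype_mk (h := fun t => (G t).2)
    (by simpa only [hG] using (continuous_measureReal_Iic μ).measurable)
  have he := MeasurableEmbedding.subtype_coe (measurableSet_Icc (a := 0) (b := μ.real univ))
  refine ⟨hm, ?_⟩
  -- A measure on the interval is recovered from its image on the line.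
  rw [← he.comap_map (Measure.map G μ), Measure.map_map he.measurable hm, hc,
    map_measureReal_Iic, ← map_comap_subtype_coe measurableSet_Icc, he.comap_map, lebMeasure]

/-- The distribution function may be constant on intervals, but only null sets are lost: its
sublevel set at the value of `t` has the same measure as the ray `Iic t` inside it. -/
theorem measure_setOf_lt_measureReal_Iic_le [NullSingletonClass μ] (t : ℝ) :
    μ {s | t < s ∧ μ.real (Iic s) ≤ μ.real (Iic t)} = 0 := by
  have hm := (continuous_measureReal_Iic μ).measurable
  have h : μ {s | μ.real (Iic s) ≤ μ.real (Iic t)} = μ (Iic t) := by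
    have := Measure.map_apply (μ := μ) hm (measurableSet_Iic (a := μ.real (Iic t)))
    rw [map_measureReal_Iic, Measure.restrict_apply measurableSet_Iic] at this
    change _ = μ {s | μ.real (Iic s) ≤ μ.real (Iic t)} at this
    rw [← this, show Iic (μ.real (Iic t)) ∩ Icc 0 (μ.real univ) = Icc 0 (μ.real (Iic t)) by
        have := measureReal_mono (μ := μ) (subset_univ (Iic t))
        ext; simp; grind, Real.volume_Icc, sub_zero, ofReal_measureReal]
  have hsub : Iic t ⊆ {s | μ.real (Iic s) ≤ μ.real (Iic t)} :=
    fun s hs => monotone_measureReal_Iic μ hs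
  have hd := measure_sdiff (μ := μ) hsub measurableSet_Iic.nullMeasurableSet
    (measure_ne_top _ _)
  rw [h, tsub_self] at hd
  refine measure_mono_null ?_ hd
  exact fun s hs => ⟨hs.2, fun h => absurd hs.1 (not_lt.2 h)⟩

/-- A Borel probability measure on the line is composed of an interval and countably many
atoms. -/
theorem exists_isMeasAlgIso_modelMeasure (μ : Measure ℝ) [IsProbabilityMeasure μ] :
    ∃ (I : Set ℝ) (_ : I.Countable) (q : I → ℝ≥0∞), (∀ i, 0 < q i) ∧
      ∃ p : ℝ, 0 ≤ p ∧ p ≤ 1 ∧ ∃ f : ℝ → Icc 0 p ⊕ I, IsMeasAlgIso f μ (modelMeasure p q) := by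
  classical
  let D : Set ℝ := {r | 0 < μ {r}}
  have hD : D.Countable :=
    Measure.countable_meas_pos_of_disjoint_iUnion (As := fun r : ℝ => {r})
      (fun _ => measurableSet_singleton _) fun r s h => by simpa using h
  let ν := μ.restrict Dᶜ
  have : NullSingletonClass ν := ⟨fun r => by
    rw [Measure.restrict_apply (measurableSet_singleton r)]
    by_cases h : r ∈ D
    · rw [show {r} ∩ Dᶜ = ∅ by ext; simp; grind, measure_empty]
    · exact measure_mono_null inter_subset_left (by simpa [D] using h)⟩
  let G : ℝ → Icc 0 (ν.real univ) := fun t => ⟨ν.real (Iic t), measureReal_nonneg,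
      measureReal_mono (subset_univ _)⟩
  have hG : MeasurePreserving G ν (lebMeasure _) := 
    measurePreserving_of_coe_eq_measureReal_Iic ν fun _ => rfl
  let f : ℝ → Icc 0 (ν.real univ) ⊕ D := fun r => if h : r ∈ D then .inr ⟨r, h⟩ else .inl (G r)
  have hf1 : ∀ r (h : r ∈ D), f r = .inr ⟨r, h⟩ := fun r h => dif_pos h
  have hf2 : ∀ r (h : r ∉ D), f r = .inl (G r) := fun r h => dif_neg h
  have hfm : Measurable f := by
    refine Measurable.dite (s := D) (f := Sum.inr) (g := fun x => Sum.inl (G x)) measurable_inr ?_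
      hD.measurableSet
    exact measurable_inl.comp (hG.measurable.comp measurable_subtype_coe)
  refine ⟨D, hD, fun i => μ {(i : ℝ)}, fun i => i.2, ν.real univ, measureReal_nonneg, ?_, f,
    ⟨hfm, ?_⟩, fun s hs => ?_⟩
  · exact (ENNReal.toReal_mono ENNReal.one_ne_top
      ((Measure.restrict_apply_le _ _).trans prob_le_one)).trans (by simp)
  · have := hD.to_subtype
    ext s hs
    rw [Measure.map_apply hfm hs, modelMeasure_apply hs, ← measure_inter_add_sdiff _ hD.measurableSet,
      add_comm]
    congr 1
    · rw [← hG.measure_preimage (measurable_inl hs).nullMeasurableSet,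
        Measure.restrict_apply (hG.measurable (measurable_inl hs))]
      congr 1
      ext r
      by_cases h : r ∈ D <;> simp [h, hf2]
    · have h := (μ.comap ((↑) : D → ℝ)).tsum_indicator_apply_singleton (Sum.inr ⁻¹' s)
        (measurable_inr hs)
      have he := MeasurableEmbedding.subtype_coe hD.measurableSet
      rw [he.comap_apply] at h
      rw [show f ⁻¹' s ∩ D = (↑) '' (Sum.inr ⁻¹' s : Set D) by
        ext r
        by_cases h : r ∈ D <;> simp [h, hf1], ← h]
      congr 1 with i
      by_cases h : Sum.inr i ∈ s <;> simp [h, he.comap_apply]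
  -- The sets that are almost preimages form a σ-algebra, so rays suffice.
  · rw [BorelSpace.measurable_eq (α := ℝ), borel_eq_generateFrom_Iic] at hs
    induction s, hs using MeasurableSpace.generateFrom_induction with
    | hC s hs _ =>
      obtain ⟨t, rfl⟩ := hs
      -- The preimage of this set is exact on atoms. Elsewhere it exceeds the ray only by points
      -- beyond `t` where the distribution function has not grown, a null set.
      refine ⟨{z | Sum.elim (fun x : Icc 0 (ν.real univ) => (x : ℝ) ≤ ν.real (Iic t))
          (fun d : D => (d : ℝ) ≤ t) z},
        measurableSet_sum_iff.2 ⟨measurableSet_le measurable_subtype_coe measurable_const,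
          measurableSet_le measurable_subtype_coe measurable_const⟩, ?_⟩
      have h := measure_setOf_lt_measureReal_Iic_le ν t
      rw [Measure.restrict_apply₀' hD.measurableSet.compl.nullMeasurableSet] at h
      rw [← measure_symmDiff_eq_zero_iff]
      refine measure_mono_null ?_ h
      rintro r (⟨h1, h2⟩ | ⟨h1, h2⟩)
      · by_cases hr : r ∈ D
        · exact absurd (by simpa [hf1 r hr] using h1) h2
        · exact ⟨⟨not_le.1 h2, by simpa [hf2 r hr, G] using h1⟩, hr⟩
      · refine absurd ?_ h2
        by_cases hr : r ∈ D
        · simpa [hf1 r hr] using h1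
        · simpa [hf2 r hr, G] using monotone_measureReal_Iic ν h1
    | empty => exact ⟨∅, .empty, .rfl⟩
    | compl s _ ih =>
      obtain ⟨t, ht, hts⟩ := ih
      exact ⟨tᶜ, ht.compl, hts.compl⟩
    | iUnion s _ ih =>
      choose t ht hts using ih
      refine ⟨⋃ i, t i, .iUnion ht, ?_⟩
      rw [preimage_iUnion]
      exact Filter.EventuallyEq.countable_iUnion hts

end RealLine

/-! ### Standard probability spaces -/

theorem exists_measurableEmbedding_nat_bool (X : Type*) [MeasurableSpace X]
    [StandardBorelSpace X] : ∃ ι : X → ℕ → Bool, MeasurableEmbedding ι := by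
  obtain ⟨ι, hm, hi⟩ := MeasurableSpace.measurable_injection_nat_bool_of_countablySeparated X
  exact ⟨ι, hm.measurableEmbedding hi⟩

theorem measurableSet_eval_eq_true (n : ℕ) : MeasurableSet {b : ℕ → Bool | b n = true} :=
  measurable_pi_apply (X := fun _ => Bool) n (measurableSet_singleton true)

namespace IsStdProbSpace

variable {X : Type u} [F : MeasurableSpace X] {μ : Measure X}

/-- The measurable sets of a standard probability space are the completion of the preimages of the
Borel sets under an injection into the Cantor space with Borel range. -/
theorem exists_embedding (h : IsStdProbSpace μ) : ∃ ι : X → ℕ → Bool, Function.Injective ι ∧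
    Measurable ι ∧ MeasurableSet (range ι) ∧ ∀ s, MeasurableSet s ↔
      ∃ t t', MeasurableSet t ∧ MeasurableSet t' ∧ ι ⁻¹' t ⊆ s ∧ s ⊆ ι ⁻¹' t' ∧
        μ (ι ⁻¹' (t' \ t)) = 0 := by
  obtain ⟨B, hB, hs⟩ := h.exists_borel
  obtain ⟨ι, hι⟩ := @exists_measurableEmbedding_nat_bool X B hB
  have hιi := hι.injective
  have hιm := hι.measurable
  have hBX : ∀ s, MeasurableSet[B] s → MeasurableSet[F] s := fun s h =>
    (hs s).2 ⟨s, s, h, h, subset_rfl, subset_rfl, by simp⟩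
  refine ⟨ι, hιi, fun s h => hBX _ (hιm h), @MeasurableEmbedding.measurableSet_range _ _ B _ _ hι,
    fun s => (hs s).trans ⟨?_, ?_⟩⟩
  · rintro ⟨t, t', ht, ht', h1, h2, h3⟩
    refine ⟨ι '' t, ι '' t', hι.measurableSet_image' ht, hι.measurableSet_image' ht', ?_⟩
    rw [preimage_sdiff, preimage_image_eq _ hιi, preimage_image_eq _ hιi]
    exact ⟨h1, h2, h3⟩
  · rintro ⟨t, t', ht, ht', h⟩
    exact ⟨_, _, hιm ht, hιm ht', h⟩

/-- A null set lies in a measurable null set, which is squeezed between Borel sets `t` and `t'`.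
Both are then null, so the given set is squeezed between `∅` and `t'`. -/
theorem isComplete (h : IsStdProbSpace μ) : μ.IsComplete := by
  obtain ⟨ι, -, -, -, hι⟩ := h.exists_embedding
  refine ⟨fun s hs => ?_⟩
  obtain ⟨r, hsr, hr, hr0⟩ := exists_measurable_superset_of_null hs
  obtain ⟨t, t', -, ht', h1, h2, h3⟩ := (hι r).1 hr
  refine (hι s).2 ⟨∅, t', .empty, ht', empty_subset _, hsr.trans h2, ?_⟩
  refine measure_mono_null ?_ (measure_union_null h3 (measure_mono_null h1 hr0))
  intro x hx
  by_cases hxt : ι x ∈ t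
  exacts [.inr hxt, .inl ⟨hx.1, hxt⟩]

/-- The space is carried to the Cantor space, then to the line, then to the model, each time without
changing the measure algebra. -/
theorem isStdAlgMeasure (h : IsStdProbSpace μ) [IsProbabilityMeasure μ] :
    IsStdAlgMeasure (MeasAlg.measure μ) := by
  obtain ⟨ι, -, hιm, -, hι⟩ := h.exists_embedding
  have h1 : IsMeasAlgIso ι μ (μ.map ι) := by
    refine ⟨hιm.measurePreserving μ, fun s hs => ?_⟩
    obtain ⟨t, t', ht, ht', h1, h2, h3⟩ := (hι s).1 hs
    refine ⟨t, ht, h1.eventuallyLE.antisymm (ae_le_set.2 (measure_mono_null ?_ h3))⟩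
    exact sdiff_subset_sdiff_left h2
  have h2 := (measurableEmbedding_embeddingReal (ℕ → Bool)).isMeasAlgIso (μ.map ι)
  have := (h2.comp h1).isProbabilityMeasure
  obtain ⟨I, hI, q, hq, p, hp, hp1, f, hf⟩ :=
    exists_isMeasAlgIso_modelMeasure ((μ.map ι).map (embeddingReal (ℕ → Bool)))
  have := hI.to_subtype
  have := hf.isProbabilityMeasure
  obtain ⟨e, he⟩ := (hf.comp (h2.comp h1)).exists_orderIso
  obtain ⟨e', he'⟩ := exists_orderIso_modelMeasure (p := p) hq
  refine isStdAlgMeasure_iff.2 ⟨I, hI, q, hq, p, hp, hp1, e.symm.trans e', fun a => ?_⟩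
  rw [← e.apply_symm_apply a, he, he']
  simp

end IsStdProbSpace

/-! ### Homomorphisms between measure algebras -/

namespace MeasAlg

theorem mk_eq_bot {X : Type*} [MeasurableSpace X] {μ : Measure X} [IsFiniteMeasure μ]
    {s : {s : Set X // MeasurableSet s}} : mk (negligibles μ) s = ⊥ ↔ μ (s : Set X) = 0 := by
  rw [mk_bot, mk_eq]
  change μ ((s : Set X) ∆ ∅) = 0 ↔ _
  rw [← bot_eq_empty, symmDiff_bot]

theorem mk_iUnion {X : Type*} [MeasurableSpace X] {N : Set (Set X)} [IsNegligibles N]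
    (s : ℕ → Set X) (hs : ∀ n, MeasurableSet (s n)) :
    mk N ⟨⋃ n, s n, .iUnion hs⟩ = ⨆ n, mk N ⟨s n, hs n⟩ := by
  have h := isLUB_cUnion (N := N) (range fun n => (⟨s n, hs n⟩ : {s : Set X // MeasurableSet s}))
    (countable_range _)
  rw [← range_comp] at h
  refine Eq.trans ?_ (h.unique isLUB_iSup)
  simp [cUnion]

variable {X Y : Type u} [MeasurableSpace X] [MeasurableSpace Y] {μ : Measure X} {ν : Measure Y}
  [IsFiniteMeasure μ] [IsFiniteMeasure ν]

/-- Maps into a standard probability space that induce the same homomorphism are equal almost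
everywhere. -/
theorem ae_eq_of_map_eq (hν : IsStdProbSpace ν) {f g : X → Y} {hf : Measurable f}
    {hg : Measurable g} {hf' : ∀ t ∈ negligibles ν, f ⁻¹' t ∈ negligibles μ}
    {hg' : ∀ t ∈ negligibles ν, g ⁻¹' t ∈ negligibles μ} (h : map f hf hf' = map g hg hg') :
    μ {x | f x ≠ g x} = 0 := by
  obtain ⟨ι, hιi, hιm, -⟩ := hν.exists_embedding
  have hn : ∀ n, MeasurableSet (ι ⁻¹' {b | b n = true}) := fun n =>
    hιm (measurableSet_eval_eq_true n)
  refine measure_mono_null (t := ⋃ n, (f ⁻¹' (ι ⁻¹' {b | b n = true})) ∆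
    (g ⁻¹' (ι ⁻¹' {b | b n = true}))) (fun x hx => ?_) (measure_iUnion_null fun n => ?_)
  · by_contra hxn
    refine hx (hιi (funext fun n => Bool.eq_iff_iff.2 ?_))
    by_contra hxn'
    refine hxn (mem_iUnion.2 ⟨n, ?_⟩)
    simp only [mem_symmDiff, mem_preimage, mem_ofPred_eq]
    tauto
  · have := DFunLike.congr_fun h (mk _ ⟨_, hn n⟩)
    rwa [map_mk, map_mk, mk_eq] at this

/-- A homomorphism from the measure algebra of a standard probability space to a measure algebra is
represented by a map. -/
theorem exists_map_eq (hμ : μ.IsComplete) (hν : IsStdProbSpace ν)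
    (φ : CompleteLatticeHom (MeasAlg (negligibles ν)) (MeasAlg (negligibles μ))) :
    ∃ (f : X → Y) (hf : Measurable f) (h : ∀ t ∈ negligibles ν, f ⁻¹' t ∈ negligibles μ),
      map f hf h = φ := by
  obtain ⟨ι, hιi, hιm, hιr, hι⟩ := hν.exists_embedding
  have hνc := hν.isComplete
  have hνp := hν.isProb
  have : Nonempty Y := nonempty_of_isProbabilityMeasure ν
  have hn : ∀ n, MeasurableSet (ι ⁻¹' {b | b n = true}) := fun n =>
    hιm (measurableSet_eval_eq_true n)
  have hE : ∀ n, ∃ E, mk (negligibles μ) E = φ (mk _ ⟨_, hn n⟩) := fun n =>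
    Quotient.exists_rep _
  choose E hE using hE
  classical
  -- If `f` represents `φ`, then `ι ∘ f` must have these coordinates almost everywhere. The values
  -- of `g` need not yet lie in `range ι`.
  let g : X → ℕ → Bool := fun x n => decide (x ∈ (E n : Set X))
  have hgE : ∀ n, g ⁻¹' {b | b n = true} = E n := fun n => by ext; simp [g]
  have hg : Measurable g := measurable_pi_iff.2 fun n => measurable_to_bool (by
    convert (E n).2
    exact hgE n)
  have key : ∀ S (hS : MeasurableSet S),
      mk (negligibles μ) ⟨g ⁻¹' S, hg hS⟩ = φ (mk _ ⟨ι ⁻¹' S, hιm hS⟩) := by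
    -- The Borel sets on which `g` induces `φ` form a σ-algebra. It contains the sets fixing one
    -- coordinate, by the choice of `E`, hence all Borel sets.
    let m : MeasurableSpace (ℕ → Bool) :=
      { MeasurableSet' S := ∃ hS : MeasurableSet S,
          mk (negligibles μ) ⟨g ⁻¹' S, hg hS⟩ = φ (mk _ ⟨ι ⁻¹' S, hιm hS⟩)
        measurableSet_empty := ⟨.empty, (map_bot φ).symm⟩
        measurableSet_compl := fun S ⟨hS, h⟩ => ⟨hS.compl, by
          change (mk (negligibles μ) ⟨g ⁻¹' S, hg hS⟩)ᶜ = φ (mk _ ⟨ι ⁻¹' S, hιm hS⟩)ᶜ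
          rw [map_compl', h]⟩
        measurableSet_iUnion := fun S h => by
          choose hS h using h
          refine ⟨.iUnion hS, ?_⟩
          have h1 := mk_iUnion (N := negligibles μ) _ fun n => hg (hS n)
          have h2 := mk_iUnion (N := negligibles ν) _ fun n => hιm (hS n)
          simp only [h, ← map_iSup, ← h2] at h1
          simpa only [preimage_iUnion] using h1 }
    have hm : MeasurableSpace.pi ≤ m := by
      have : @Measurable _ _ m MeasurableSpace.pi (id : (ℕ → Bool) → ℕ → Bool) :=
        (@measurable_pi_iff _ _ _ m _ _).2 fun n => @measurable_to_bool _ m _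
          ⟨measurableSet_eval_eq_true n,
            (congrArg (mk _) (Subtype.ext (hgE n))).trans (hE n)⟩
      exact fun S hS => this hS
    exact fun S hS => (hm S hS).2
  have key0 : ∀ S, MeasurableSet S → ν (ι ⁻¹' S) = 0 → μ (g ⁻¹' S) = 0 := by
    intro S hS h
    have h1 := key S hS
    rwa [mk_eq_bot.2 (show ν ↑(⟨_, hιm hS⟩ : {s : Set Y // MeasurableSet s}) = 0 from h), map_bot,
      mk_eq_bot] at h1
  -- The complement of `range ι` is Borel with empty preimage under `ι`, so its preimage under `g`
  -- is null.
  have hr : ∀ᵐ x ∂μ, g x ∈ range ι := key0 _ hιr.compl (by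
    rw [Set.preimage_compl, preimage_range, compl_univ, measure_empty])
  -- Off `range ι`, `Function.invFun` returns an arbitrary point; this happens only on a null set.
  let f : X → Y := fun x => Function.invFun ι (g x)
  have hfg : ∀ S, f ⁻¹' (ι ⁻¹' S) =ᵐ[μ] g ⁻¹' S := by
    intro S
    filter_upwards [hr] with x hx
    have : ι (f x) = g x := Function.invFun_eq hx
    change (ι (f x) ∈ S) = (g x ∈ S)
    rw [this]
  -- A general `s` is only squeezed between Borel sets, so `f ⁻¹' s` is a priori only
  -- null-measurable; completeness of `μ` makes it measurable.
  have hfs : ∀ s (hs : MeasurableSet s), ∃ hs' : MeasurableSet (f ⁻¹' s),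
      mk (negligibles μ) ⟨_, hs'⟩ = φ (mk _ ⟨s, hs⟩) := by
    intro s hs
    obtain ⟨t, t', ht, ht', h1, h2, h3⟩ := (hι s).1 hs
    have hle : g ⁻¹' t' ≤ᵐ[μ] g ⁻¹' t := ae_le_set.2 (key0 _ (ht'.diff ht) h3)
    have hae : f ⁻¹' s =ᵐ[μ] g ⁻¹' t :=
      (((Set.preimage_mono h2).eventuallyLE.trans (hfg t').le).trans hle).antisymm
        ((hfg t).symm.le.trans (Set.preimage_mono h1).eventuallyLE)
    refine ⟨((hg ht).nullMeasurableSet.congr hae.symm).measurable_of_complete, ?_⟩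
    have hst : mk (negligibles ν) ⟨s, hs⟩ = mk _ ⟨_, hιm ht⟩ := by
      refine mk_eq.2 (measure_symmDiff_eq_zero_iff.2 ?_)
      exact (ae_le_set.2 (measure_mono_null (sdiff_subset_sdiff_left h2) h3)).antisymm
        h1.eventuallyLE
    rw [hst, ← key t ht]
    exact mk_eq.2 (measure_symmDiff_eq_zero_iff.2 hae)
  have hfm : Measurable f := fun s hs => (hfs s hs).1
  refine ⟨f, hfm, fun s hs => ?_, CompleteLatticeHom.ext fun a => ?_⟩
  · have hsm : MeasurableSet s := measurableSet_of_null hs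
    obtain ⟨hs', h⟩ := hfs s hsm
    rwa [mk_eq_bot.2 (show ν ↑(⟨s, hsm⟩ : {s : Set Y // MeasurableSet s}) = 0 from hs), map_bot,
      mk_eq_bot] at h
  · induction a using MeasAlg.ind with | _ s
    exact (hfs s s.2).2

end MeasAlg

/-! ### Realizing standard probability algebras -/

/-- The completion of a Borel probability measure on a standard Borel space. -/
theorem isStdProbSpace_completion {Y : Type u} [B : MeasurableSpace Y] [StandardBorelSpace Y]
    (ν : Measure Y) [hν : IsProbabilityMeasure ν] : IsStdProbSpace ν.completion where
  isProb := ⟨hν.measure_univ⟩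
  exists_borel := by
    refine ⟨B, ‹_›, fun s => ⟨fun hs => ?_, ?_⟩⟩
    · have hs : NullMeasurableSet (α := Y) s ν := hs
      obtain ⟨t, hts, ht, hte⟩ := hs.exists_measurable_subset_ae_eq
      obtain ⟨t', hts', ht', hte'⟩ := hs.exists_measurable_superset_ae_eq
      exact ⟨t, t', ht, ht', hts, hts', ae_le_set.1 (hte'.trans hte.symm).le⟩
    · rintro ⟨t, t', ht, ht', h1, h2, h3⟩
      have h : (t : Set Y) =ᵐ[ν] s := by
        refine h1.eventuallyLE.antisymm (ae_le_set.2 (measure_mono_null ?_ h3))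
        exact sdiff_subset_sdiff_left h2
      exact NullMeasurableSet.congr (α := Y) ht.nullMeasurableSet h

theorem isMeasAlgIso_completion {Y : Type*} [MeasurableSpace Y] (ν : Measure Y) :
    IsMeasAlgIso (X := NullMeasurableSpace Y ν) (Y := Y) id ν.completion ν where
  measurePreserving := by
    have hm : @Measurable (NullMeasurableSpace Y ν) Y _ _ id := fun s hs => hs.nullMeasurableSet
    refine ⟨hm, ?_⟩
    ext s hs
    exact Measure.map_apply hm hs
  exists_ae_eq s hs := by
    have hs : NullMeasurableSet (α := Y) s ν := hs
    obtain ⟨t, -, ht, hte⟩ := hs.exists_measurable_subset_ae_eq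
    exact ⟨t, ht, hte⟩

/-- The witness is the completion of the model with the parameters of `A`, lifted to the universe of
`A`. Its total mass is `μ ⊤ = 1`. -/
theorem IsStdAlgMeasure.exists_stdProb {A : Type u} [CompleteBooleanAlgebra A] {μ : A → ℝ≥0∞}
    (h : IsStdAlgMeasure μ) (hμ : IsProbAlgMeasure μ) :
    ∃ (X : StdProb.{u}) (e : A ≃o MeasAlg (negligibles X.μ)),
      ∀ a, MeasAlg.measure X.μ (e a) = μ a := by
  obtain ⟨I, hI, q, hq, p, hp, hp1, e, he⟩ := isStdAlgMeasure_iff.1 h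
  let _ : MeasurableSpace I := ⊤
  have hprob : IsProbabilityMeasure (modelMeasure p q) := ⟨by
    rw [modelMeasure_univ, ← hμ.top, he, map_top]
    rfl⟩
  obtain ⟨e₁, he₁⟩ := exists_orderIso_modelMeasure (p := p) hq
  let Y := ULift.{u} (Icc (0 : ℝ) p ⊕ I)
  let ν : Measure Y := (modelMeasure p q).map ULift.up
  have hν : IsMeasAlgIso ULift.down ν (modelMeasure p q) := by
    have := (MeasurableEquiv.ulift.{0, u} (α := Icc (0 : ℝ) p ⊕ I)).measurableEmbedding
      |>.isMeasAlgIso ν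
    change IsMeasAlgIso ULift.down ν (Measure.map ULift.down ν) at this
    rwa [Measure.map_map measurable_down measurable_up, show ULift.down ∘ ULift.up = id from rfl,
      Measure.map_id] at this
  have : IsProbabilityMeasure ν := Measure.isProbabilityMeasure_map measurable_up.aemeasurable
  obtain ⟨X, f, hf⟩ : ∃ (X : StdProb.{u}) (f : X.carrier → Icc (0 : ℝ) p ⊕ I),
      IsMeasAlgIso f X.μ (modelMeasure p q) :=
    ⟨⟨NullMeasurableSpace Y ν, ν.completion, isStdProbSpace_completion ν⟩, _,
      hν.comp (isMeasAlgIso_completion ν)⟩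
  obtain ⟨e₂, he₂⟩ := hf.exists_orderIso
  refine ⟨X, (e.trans e₁.symm).trans e₂, fun a => ?_⟩
  rw [he a, OrderIso.trans_apply, he₂, ← e₁.apply_symm_apply (e a), he₁]
  simp

/-! ### The equivalences of categories -/

/-- Fullness and faithfulness pass to the lift and to its opposite, so only essential surjectivity
needs an argument; isomorphisms in a full subcategory are those of the ambient category. -/
theorem CategoryTheory.ObjectProperty.isEquivalence_rightOp_lift {C D : Type*} [Category* C]
    [Category* D] (P : ObjectProperty D) (F : Cᵒᵖ ⥤ D) [F.Full] [F.Faithful]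
    (hF : ∀ X, P (F.obj X)) (h : ∀ A, P A → ∃ X : C, Nonempty (F.obj (.op X) ≅ A)) :
    ((P.lift F hF).rightOp : C ⥤ P.FullSubcategoryᵒᵖ).IsEquivalence where
  essSurj := ⟨fun A => by
    obtain ⟨X, ⟨i⟩⟩ := h A.unop.obj A.unop.property
    exact ⟨X, ⟨(P.isoMk (X := A.unop) (Y := (P.lift F hF).obj (.op X)) i.symm).op⟩⟩⟩

namespace StdProb

instance : StdProb.measAlg.{u}.Faithful where
  map_injective := by
    rintro ⟨Y⟩ ⟨X⟩ ⟨⟨f⟩⟩ ⟨⟨g⟩⟩ h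
    exact Quiver.Hom.unop_inj (Quotient.sound (s := homSetoid X Y)
      (MeasAlg.ae_eq_of_map_eq Y.std (congrArg Subtype.val h)))

instance : StdProb.measAlg.{u}.Full where
  map_surjective := by
    rintro ⟨Y⟩ ⟨X⟩ ⟨φ, hφ⟩
    obtain ⟨f, hf, h, rfl⟩ := MeasAlg.exists_map_eq X.std.isComplete Y.std φ
    have hmp : MeasurePreserving f X.μ Y.μ :=
      ⟨hf, Measure.ext fun s hs => by
        rw [Measure.map_apply hf hs]
        -- Measure preservation of `φ` at the class of `s` is measure preservation of `f` at `s`.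
        exact hφ (MeasAlg.mk _ ⟨s, hs⟩)⟩
    exact ⟨Quiver.Hom.op (Quotient.mk (homSetoid X Y) ⟨f, hmp⟩), rfl⟩

theorem exists_iso (A : ProbAlg.{u}) (hA : ProbAlg.IsStandard A) :
    ∃ X : StdProb.{u}, Nonempty (StdProb.measAlg.obj (.op X) ≅ A) := by
  obtain ⟨X, e, he⟩ := IsStdAlgMeasure.exists_stdProb hA A.isProb
  refine ⟨X, ⟨⟨⟨CompleteLatticeHom.OrderIso.toCompleteLatticeHom e.symm, fun a => ?_⟩,
    ⟨CompleteLatticeHom.OrderIso.toCompleteLatticeHom e, he⟩, ?_, ?_⟩⟩⟩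
  · exact (he _).symm.trans (congrArg _ (e.apply_symm_apply a))
  · exact Subtype.ext (CompleteLatticeHom.ext fun a => e.apply_symm_apply a)
  · exact Subtype.ext (CompleteLatticeHom.ext fun a => e.symm_apply_apply a)

end StdProb

namespace StdMble

instance : StdMble.measAlg.{u}.Faithful where
  map_injective := by
    rintro ⟨Y, M, ν, hν, rfl⟩ ⟨X, N, μ, hμ, rfl⟩ ⟨⟨f⟩⟩ ⟨⟨g⟩⟩ h
    have := hμ.isProb
    have := hν.isProb
    exact Quiver.Hom.unop_inj (Quotient.sound (s := homSetoid _ _)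
      (MeasAlg.ae_eq_of_map_eq hν (congrArg Subtype.val h)))

instance : StdMble.measAlg.{u}.Full where
  map_surjective := by
    rintro ⟨Y, M, ν, hν, rfl⟩ ⟨X, N, μ, hμ, rfl⟩ ⟨φ, hφ⟩
    have := hμ.isProb
    have := hν.isProb
    obtain ⟨f, hf, h, rfl⟩ := MeasAlg.exists_map_eq hμ.isComplete hν φ
    refine ⟨Quiver.Hom.op (Quotient.mk (homSetoid _ _) ⟨f, hf, h, fun G hG hG0 => ?_⟩), rfl⟩
    -- A null preimage of `G` means that `φ` sends `[G]` to `⊥`, so injectivity forces `[G] = ⊥`.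
    refine MeasAlg.mk_eq_bot.1 (hφ (a₁ := MeasAlg.mk (negligibles ν) ⟨G, hG⟩) (a₂ := ⊥) ?_)
    exact (MeasAlg.mk_eq_bot (μ := μ) (s := ⟨f ⁻¹' G, hf hG⟩).2 hG0).trans (map_bot _).symm

/-- The measure on `A` serves only to build the space and is then forgotten; an order isomorphism
and its inverse are injective complete homomorphisms. -/
theorem exists_iso (A : MbleAlg.{u}) (hA : MbleAlg.IsStandard A) :
    ∃ X : StdMble.{u}, Nonempty (StdMble.measAlg.obj (.op X) ≅ A) := by
  obtain ⟨ρ, hρ, hA⟩ := hA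
  obtain ⟨X, e, -⟩ := hA.exists_stdProb hρ
  refine ⟨⟨X.carrier, negligibles X.μ, X.μ, X.std, rfl⟩,
    ⟨⟨⟨CompleteLatticeHom.OrderIso.toCompleteLatticeHom e.symm, e.symm.injective⟩,
      ⟨CompleteLatticeHom.OrderIso.toCompleteLatticeHom e, e.injective⟩,
      ?_, ?_⟩⟩⟩
  · exact Subtype.ext (CompleteLatticeHom.ext fun a => e.apply_symm_apply a)
  · exact Subtype.ext (CompleteLatticeHom.ext fun a => e.symm_apply_apply a)

theorem isStandard_measAlg (X : StdMble.{u}ᵒᵖ) : MbleAlg.IsStandard (StdMble.measAlg.obj X) := by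
  obtain ⟨X, N, μ, hμ, rfl⟩ := X
  have := hμ.isProb
  exact ⟨MeasAlg.measure μ, MeasAlg.isProbAlgMeasure μ, hμ.isStdAlgMeasure⟩

end StdMble

theorem mainTheorem12 :
    (∃ h : ∀ X : StdMble.{u}ᵒᵖ, MbleAlg.IsStandard (StdMble.measAlg.obj X),
      ((MbleAlg.IsStandard.lift StdMble.measAlg h).rightOp :
        StdMble.{u} ⥤ StdMbleAlg.{u}ᵒᵖ).IsEquivalence) ∧
    (∃ h : ∀ X : StdProb.{u}ᵒᵖ, ProbAlg.IsStandard (StdProb.measAlg.obj X),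
      ((ProbAlg.IsStandard.lift StdProb.measAlg h).rightOp :
        StdProb.{u} ⥤ StdProbAlg.{u}ᵒᵖ).IsEquivalence) :=
  ⟨⟨StdMble.isStandard_measAlg,
    ObjectProperty.isEquivalence_rightOp_lift _ _ _ StdMble.exists_iso⟩,
   ⟨fun X => X.unop.std.isStdAlgMeasure,
    ObjectProperty.isEquivalence_rightOp_lift _ _ _ StdProb.exists_iso⟩⟩
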